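/- Let $A:\mathbb R\to\mathbb R^d$ be a $C^1$ function and $a=A'$. Let $\Omega\subset\mathbb R^d$ be open and let $u\in L^\infty(\Omega)$ be a continuous entropy solution of $\operatorname{div}A(u)=a(u)\cdot\nabla u=0$ in $\Omega$, that is, $$\int_\Omega q(u)\cdot\nabla\varphi\,dx\ \ge\ 0$$ for every convex $\eta:\mathbb R\to\mathbb R$, every $q:\mathbb R\to\mathbb R^d$ with $q'=\eta' a$ (i.e. $q(v)=q(0)+\int_0^v\eta'(s)a(s)\,ds$, where $\eta'$ is the right derivative), and every $0\le\varphi\in C_c^\infty(\Omega)$. Then: 1. For every $x_0\in\Omega$ and all $r,s>0$ such that $\{x_0+t\,a(u(x_0)) : t\in(-r,s)\}\subset\Omega$, the function $u$ is constant, equal to $u(x_0)$, on this segment. 2. There is no entropy dissipation: let $f(x,v)=1$ if $0<v<u(x)$, $f(x,v)=-1$ if $u(x)<v<0$, and $f(x,v)=0$ otherwise. Then $a(v)\cdot\nabla_x f=0$ in the sense of distributions in $\Omega\times\mathbb R$, and if $\mu$ is a nonnegative Borel measure on $\Omega\times\mathbb R$ with $\mu(K\times\mathbb R)<\infty$ for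 all compact $K\subset\Omega$ and $a(v)\cdot\nabla_x f=\partial_v\mu$ in the sense of distributions (a kinetic entropy dissipation measure of $u$), then $\mu=0$. 3. Equality holds in the entropy inequalities: $\int_\Omega q(u)\cdot\nabla\varphi\,dx=0$ for every convex $\eta$, every $q$ with $q'=\eta' a$ as above, and every $\varphi\in C_c^\infty(\Omega)$. -/

import Mathlib

open MeasureTheory Set
open scoped ContDiff

/-- Real-valued test functions on the open set `U`: smooth, with compact support inside `U`. -/
structure IsTestFunction {V : Type*} [NormedAddCommGroup V] [NormedSpace ℝ V]
    (U : Set V) (φ : V → ℝ) : Prop where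
  smooth : ContDiff ℝ ∞ φ
  compact : HasCompactSupport φ
  support_subset : tsupport φ ⊆ U

/-- `q` is an entropy flux for the convex entropy `η` and the velocity `a`, that is `q' = η' a`.
A convex function need not be differentiable at countably many points; there `η'` is the
right derivative (which exists everywhere), and `q` is the primitive of `η' a`. -/
def IsEntropyFlux {d : ℕ} (a : ℝ → EuclideanSpace ℝ (Fin d)) (η : ℝ → ℝ)
    (q : ℝ → EuclideanSpace ℝ (Fin d)) : Prop :=
  ∀ v : ℝ, q v = q 0 + ∫ s in (0 : ℝ)..v, derivWithin η (Ioi s) s • a s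

/-- `u ∈ L^∞(Ω)` is an entropy solution of `a(u) · ∇u = 0` in `Ω`:
`∫ q(u) · ∇φ ≥ 0` for all convex entropies, their fluxes `q`, and all test functions `φ ≥ 0`.
(`fderiv ℝ φ x w` is `w · ∇φ(x)`.) -/
structure IsEntropySolution {d : ℕ} (a : ℝ → EuclideanSpace ℝ (Fin d))
    (Ω : Set (EuclideanSpace ℝ (Fin d))) (u : EuclideanSpace ℝ (Fin d) → ℝ) : Prop where
  bounded : MemLp u ⊤ (volume.restrict Ω)
  entropy : ∀ (η : ℝ → ℝ) (q : ℝ → EuclideanSpace ℝ (Fin d)),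
    ConvexOn ℝ univ η → IsEntropyFlux a η q →
    ∀ φ : EuclideanSpace ℝ (Fin d) → ℝ, IsTestFunction Ω φ → (∀ x, 0 ≤ φ x) →
      0 ≤ ∫ x in Ω, fderiv ℝ φ x (q (u x))

open Classical in
/-- The kinetic function: `1` if `0 < v < u(x)`, `-1` if `u(x) < v < 0`, and `0` otherwise. -/
noncomputable def kineticFunction {X : Type*} (u : X → ℝ) (x : X) (v : ℝ) : ℝ :=
  if 0 < v ∧ v < u x then 1 else if u x < v ∧ v < 0 then -1 else 0

/-- The nonnegative measure `μ` is a kinetic entropy dissipation measure of `u` in `Ω × ℝ`: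
`a(v) · ∇_x f = ∂_v μ` in the sense of distributions in `Ω × ℝ`, where `f` is the kinetic
function of `u`, and `μ (K × ℝ) < ∞` for compact `K ⊆ Ω`. (Only the restriction of `μ` to
`Ω × ℝ` matters. Finiteness on `K × ℝ` makes that restriction unique.) -/
structure IsKineticDissipation {d : ℕ} (a : ℝ → EuclideanSpace ℝ (Fin d))
    (Ω : Set (EuclideanSpace ℝ (Fin d))) (u : EuclideanSpace ℝ (Fin d) → ℝ)
    (μ : Measure (EuclideanSpace ℝ (Fin d) × ℝ)) : Prop where
  finite : ∀ K : Set (EuclideanSpace ℝ (Fin d)), IsCompact K → K ⊆ Ω →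
    μ (K ×ˢ (univ : Set ℝ)) < ⊤
  equation : ∀ φ : EuclideanSpace ℝ (Fin d) × ℝ → ℝ,
    IsTestFunction (Ω ×ˢ (univ : Set ℝ)) φ →
    ∫ p in Ω ×ˢ (univ : Set ℝ), kineticFunction u p.1 p.2 * fderiv ℝ φ p (a p.2, 0)
      = ∫ p in Ω ×ˢ (univ : Set ℝ), fderiv ℝ φ p (0, 1) ∂μ

/-! The entropies `max v k` make `u` a Kruzhkov subsolution. On a thin parabolic region around a
characteristic, a test function decreasing along the flow turns the entropy inequality into an
integral of a nonpositive quantity that must be nonnegative. So a bound `u ≤ k` at the base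
propagates downstream (`KruzhkovIneq.le_of_lt`). Letting `k` decrease to `u x₀`, and applying the
same to `-u`, gives constancy forward along characteristics (`KruzhkovIneq.eq_along`).

The inequalities have a direction, so going backward needs zero dissipation. By forward constancy
each `{u > v}` is stable under small shifts by `-a v`. Hence for `φ ≥ 0` the integral of `∇φ · a v`
over `{u > v}` is nonnegative. By the layer cake formula these integrals sum over `v` to the weak
form of the equation itself, which is zero; so almost all of them vanish
(`ConstForward.ae_level_eq_zero`). Equality then holds for the Kruzhkov entropies, so `u` also
solves the reversed problem with flux `-A`, and the forward result applies to it
(`IsEntropySolution.constBackward`).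

With both directions, the level sets are locally invariant under `a v` for every `v`, which gives
the kinetic equation without source and equality for all entropies. A dissipation measure is then
independent of `v` while finite on each `K × ℝ`, hence zero. -/

open Filter Topology

/-! ### Test functions and their derivatives. -/

section TestFunction

variable {E : Type*} [NormedAddCommGroup E] [NormedSpace ℝ E]

theorem IsTestFunction.continuous {U : Set E} {φ : E → ℝ} (hφ : IsTestFunction U φ) :
    Continuous φ := hφ.smooth.continuous

theorem IsTestFunction.continuous_fderiv {U : Set E} {φ : E → ℝ} (hφ : IsTestFunction U φ) :
    Continuous (fderiv ℝ φ) := hφ.smooth.continuous_fderiv (by simp)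

theorem IsTestFunction.fderiv_eq_zero {U : Set E} {φ : E → ℝ} (_hφ : IsTestFunction U φ) {x : E}
    (hx : x ∉ tsupport φ) : fderiv ℝ φ x = 0 := by
  have h := support_fderiv_subset ℝ (f := φ)
  by_contra h0
  exact hx (h h0)

theorem IsTestFunction.exists_bound {U : Set E} {φ : E → ℝ} (hφ : IsTestFunction U φ) :
    ∃ C, ∀ x, ‖fderiv ℝ φ x‖ ≤ C :=
  (hφ.compact.fderiv ℝ).exists_bound_of_continuous hφ.continuous_fderiv

/-- Cutting off a set outside a large ball changes neither the integral of a derivative of a test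
function nor the short translates of the set near the support of the test function. -/
theorem exists_ball_cutoff [MeasurableSpace E] {μ : Measure E} {U : Set E} {φ : E → ℝ} (hφ : IsTestFunction U φ)
    {W : Set E} (hW : MeasurableSet W) (w : E) :
    ∃ R : ℝ, ∫ x in W, fderiv ℝ φ x w ∂μ = ∫ x in W ∩ Metric.closedBall 0 R, fderiv ℝ φ x w ∂μ ∧
      ∀ x ∈ tsupport φ, ∀ s ∈ Icc (0 : ℝ) 1, x - s • w ∈ Metric.closedBall 0 R := by
  obtain ⟨R, hR⟩ := hφ.compact.isBounded.exists_norm_le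
  have key : ∀ x ∈ tsupport φ, ∀ s ∈ Icc (0 : ℝ) 1,
      x - s • w ∈ Metric.closedBall 0 (R + ‖w‖) := by
    intro x hx s hs
    rw [mem_closedBall_zero_iff]
    refine (norm_sub_le _ _).trans (add_le_add (hR x hx) ?_)
    rw [norm_smul, Real.norm_of_nonneg hs.1]
    exact mul_le_of_le_one_left (norm_nonneg _) hs.2
  refine ⟨R + ‖w‖, ?_, key⟩
  refine setIntegral_eq_of_subset_of_forall_sdiff_eq_zero hW inter_subset_left fun x hx ↦ ?_
  have hxt : x ∉ tsupport φ := fun h ↦ hx.2 ⟨hx.1, by simpa using key x h 0 (by simp)⟩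
  simp [hφ.fderiv_eq_zero hxt]

theorem IsTestFunction.integrableOn_fderiv_apply [MeasurableSpace E] [BorelSpace E]
    {μ : Measure E} [IsFiniteMeasureOnCompacts μ] {U : Set E} {φ : E → ℝ}
    (hφ : IsTestFunction U φ) {w : E → E} (hw : ContinuousOn w U) :
    IntegrableOn (fun x ↦ fderiv ℝ φ x (w x)) U μ := by
  have h1 : IntegrableOn (fun x ↦ fderiv ℝ φ x (w x)) (tsupport φ) μ :=
    ((hφ.continuous_fderiv.continuousOn.clm_apply hw).mono
      hφ.support_subset).integrableOn_compact hφ.compact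
  refine ((integrableOn_iff_integrable_of_support_subset ?_).1 h1).integrableOn
  intro x hx
  by_contra hxt
  exact hx (by simp [hφ.fderiv_eq_zero hxt])

end TestFunction

/-! ### Directional derivatives tested on sets, via translations. -/

section Translation

variable {E : Type*} [NormedAddCommGroup E] [NormedSpace ℝ E] [FiniteDimensional ℝ E]
  [MeasurableSpace E] [BorelSpace E] {μ : Measure E} [μ.IsAddHaarMeasure]

/-- Discrete integration by parts: a change of variables moves the difference quotient from `φ` to
the indicator of `W`. Finite measure makes the indicator integrable. -/
theorem tendsto_integral_translate_sub {U : Set E} {φ : E → ℝ} (hφ : IsTestFunction U φ)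
    {W : Set E} (hW : MeasurableSet W) (hfin : μ W ≠ ⊤) (w : E) :
    Tendsto (fun s : ℝ ↦ s⁻¹ * ∫ x, φ x * (W.indicator 1 (x - s • w) - W.indicator 1 x) ∂μ)
      (𝓝[>] 0) (𝓝 (∫ x in W, fderiv ℝ φ x w ∂μ)) := by
  obtain ⟨C, hC⟩ : ∃ C, LipschitzWith C φ :=
    hφ.smooth.lipschitzWith_of_hasCompactSupport hφ.compact (by simp)
  set g : E → ℝ := W.indicator 1 with hg
  have hgi : Integrable g μ := (integrable_indicator_iff hW).2 (integrableOn_const hfin)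
  have hgt (s : ℝ) : Integrable (fun x ↦ g (x - s • w)) μ := hgi.comp_sub_right _
  obtain ⟨B, hB⟩ := hφ.compact.exists_bound_of_continuous hφ.continuous
  have hmul {f : E → ℝ} (hf : Integrable f μ) : Integrable (fun x ↦ φ x * f x) μ :=
    hf.bdd_mul hφ.continuous.aestronglyMeasurable (ae_of_all _ hB)
  have h := LipschitzWith.integral_inv_smul_sub_mul_tendsto_integral_lineDeriv_mul hC hgi w
  have h1 : ∫ x, lineDeriv ℝ φ x w * g x ∂μ = ∫ x in W, fderiv ℝ φ x w ∂μ := by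
    rw [← integral_indicator hW]
    congr 1 with x
    rw [(hφ.smooth.differentiable (by simp)).differentiableAt.lineDeriv_eq_fderiv]
    by_cases hx : x ∈ W <;> simp [hg, hx]
  rw [h1] at h
  refine h.congr fun s ↦ ?_
  simp_rw [smul_eq_mul, mul_assoc, integral_const_mul]
  congr 1
  have h2 : Integrable (fun x ↦ φ (x + s • w) * g x) μ := by
    have := (hmul (hgt s)).comp_add_right (s • w)
    simpa using this
  simp_rw [sub_mul, mul_sub]
  rw [integral_sub h2 (hmul hgi), integral_sub (hmul (hgt s)) (hmul hgi)]
  congr 1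
  rw [← integral_add_right_eq_self (fun x ↦ φ x * g (x - s • w)) (s • w)]
  simp

theorem setIntegral_fderiv_nonneg {U : Set E} {φ : E → ℝ} (hφ : IsTestFunction U φ)
    (hpos : ∀ x, 0 ≤ φ x) {W : Set E} (hW : MeasurableSet W) (w : E)
    (h : ∀ᶠ s : ℝ in 𝓝[>] 0, ∀ x ∈ tsupport φ, x ∈ W → x - s • w ∈ W) :
    0 ≤ ∫ x in W, fderiv ℝ φ x w ∂μ := by
  obtain ⟨R, hR, hb⟩ := exists_ball_cutoff (μ := μ) hφ hW w
  rw [hR]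
  have hfin : μ (W ∩ Metric.closedBall 0 R) ≠ ⊤ :=
    (measure_mono inter_subset_right |>.trans_lt
      (isCompact_closedBall (0 : E) R).measure_lt_top).ne
  refine ge_of_tendsto (tendsto_integral_translate_sub hφ
    (hW.inter Metric.isClosed_closedBall.measurableSet) hfin w) ?_
  filter_upwards [h, self_mem_nhdsWithin, Ioc_mem_nhdsGT zero_lt_one] with s hs h0 h1
  refine mul_nonneg (inv_nonneg.2 (le_of_lt h0)) (integral_nonneg fun x ↦ ?_)
  by_cases hx : x ∈ tsupport φ
  · refine mul_nonneg (hpos x) (sub_nonneg.2 ?_)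
    by_cases hxW : x ∈ W ∩ Metric.closedBall 0 R
    · have : x - s • w ∈ W ∩ Metric.closedBall 0 R := ⟨hs x hx hxW.1, hb x hx s ⟨h1.1.le, h1.2⟩⟩
      simp [indicator_of_mem hxW, indicator_of_mem this]
    · rw [indicator_of_notMem hxW]
      exact indicator_nonneg (fun _ _ ↦ zero_le_one) _
  · simp [image_eq_zero_of_notMem_tsupport hx]

theorem setIntegral_fderiv_eq_zero {U : Set E} {φ : E → ℝ} (hφ : IsTestFunction U φ)
    {W : Set E} (hW : MeasurableSet W) (w : E)
    (h : ∀ᶠ s : ℝ in 𝓝[>] 0, ∀ x ∈ tsupport φ, x ∈ W ↔ x - s • w ∈ W) :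
    ∫ x in W, fderiv ℝ φ x w ∂μ = 0 := by
  obtain ⟨R, hR, hb⟩ := exists_ball_cutoff (μ := μ) hφ hW w
  rw [hR]
  have hfin : μ (W ∩ Metric.closedBall 0 R) ≠ ⊤ :=
    (measure_mono inter_subset_right |>.trans_lt
      (isCompact_closedBall (0 : E) R).measure_lt_top).ne
  refine tendsto_nhds_unique (tendsto_integral_translate_sub hφ
    (hW.inter Metric.isClosed_closedBall.measurableSet) hfin w)
    (tendsto_const_nhds.congr' ?_)
  filter_upwards [h, Ioc_mem_nhdsGT zero_lt_one] with s hs h1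
  symm
  refine mul_eq_zero_of_right _ (integral_eq_zero_of_ae (ae_of_all _ fun x ↦ ?_))
  by_cases hx : x ∈ tsupport φ
  · have hm : x ∈ W ∩ Metric.closedBall 0 R ↔ x - s • w ∈ W ∩ Metric.closedBall 0 R := by
      have h0 := hb x hx 0 (by simp)
      have hs' := hb x hx s ⟨h1.1.le, h1.2⟩
      rw [zero_smul, sub_zero] at h0
      simp only [mem_inter_iff, h0, hs', and_true, hs x hx]
    by_cases hxW : x ∈ W ∩ Metric.closedBall 0 R
    · simp [indicator_of_mem hxW, indicator_of_mem (hm.1 hxW)]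
    · simp [indicator_of_notMem hxW, indicator_of_notMem (mt hm.2 hxW)]
  · simp [image_eq_zero_of_notMem_tsupport hx]

end Translation

/-! ### Comparison with a constant by a barrier test function. -/

section Barrier

theorem hasDerivAt_expNegInvGlue (x : ℝ) :
    HasDerivAt expNegInvGlue ((x⁻¹) ^ 2 * expNegInvGlue x) x := by
  have h := expNegInvGlue.hasDerivAt_polynomial_eval_inv_mul 1 x
  simpa using h

variable {E : Type*} [NormedAddCommGroup E] [NormedSpace ℝ E]

/-- The barrier test function that cuts off `{m < t} ∩ {0 < s}`. -/
noncomputable def barrier {X : Type*} (m s : X → ℝ) (t : ℝ) (x : X) : ℝ :=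
  expNegInvGlue (t - m x) * Real.smoothTransition (s x)

theorem barrier_nonneg {X : Type*} (m s : X → ℝ) (t : ℝ) (x : X) : 0 ≤ barrier m s t x :=
  mul_nonneg (expNegInvGlue.nonneg _) (Real.smoothTransition.nonneg _)

theorem barrier_eq_zero {X : Type*} {m s : X → ℝ} {t : ℝ} {x : X} (h : ¬ (m x < t ∧ 0 < s x)) :
    barrier m s t x = 0 := by
  rw [not_and_or, not_lt, not_lt] at h
  rcases h with h | h
  · simp [barrier, h]
  · simp [barrier, Real.smoothTransition.zero_of_nonpos h]

theorem isTestFunction_barrier {Ω : Set E} {m s : E → ℝ} (hm : ContDiff ℝ ∞ m)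
    (hs : ContDiff ℝ ∞ s) {t T : ℝ} (htT : t ≤ T) (hN : IsCompact {x | 0 ≤ s x ∧ m x ≤ T})
    (hNΩ : {x | 0 ≤ s x ∧ m x ≤ T} ⊆ Ω) : IsTestFunction Ω (barrier m s t) := by
  have hsub : tsupport (barrier m s t) ⊆ {x | 0 ≤ s x ∧ m x ≤ T} := by
    refine closure_minimal (fun x hx ↦ ?_) hN.isClosed
    by_contra hx'
    refine hx (barrier_eq_zero fun h ↦ hx' ⟨h.2.le, h.1.le.trans htT⟩)
  refine ⟨?_, hN.of_isClosed_subset (isClosed_tsupport _) hsub, hsub.trans hNΩ⟩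
  exact (expNegInvGlue.contDiff.comp (contDiff_const.sub hm)).mul
    (Real.smoothTransition.contDiff.comp hs)

theorem fderiv_barrier {m s : E → ℝ} (hm : ContDiff ℝ ∞ m) (hs : Continuous s) {t : ℝ} {x : E}
    (hx : 1 < s x) (w : E) : fderiv ℝ (barrier m s t) x w =
      -(((t - m x)⁻¹) ^ 2 * expNegInvGlue (t - m x) * fderiv ℝ m x w) := by
  have h : barrier m s t =ᶠ[𝓝 x] fun y ↦ expNegInvGlue (t - m y) := by
    filter_upwards [hs.continuousAt.eventually (lt_mem_nhds hx)] with y hy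
    simp [barrier, Real.smoothTransition.one_of_one_le hy.le]
  have hd : HasFDerivAt m (fderiv ℝ m x) x :=
    (hm.differentiable (by simp)).differentiableAt.hasFDerivAt
  have := (hasDerivAt_expNegInvGlue (t - m x)).comp_hasFDerivAt x (hd.const_sub t)
  rw [h.fderiv_eq, show (fun y ↦ expNegInvGlue (t - m y)) = expNegInvGlue ∘ fun y ↦ t - m y from rfl,
    this.fderiv]
  simp

variable [MeasurableSpace E] {μ : Measure E}

/-- The entropy inequalities of `div A(u) = 0` for the entropies `v ↦ max v k`, `k ∈ ℝ`. -/
def KruzhkovIneq (μ : Measure E) (A : ℝ → E) (Ω : Set E) (u : E → ℝ) : Prop :=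
  ∀ (k : ℝ) (φ : E → ℝ), IsTestFunction Ω φ → (∀ x, 0 ≤ φ x) →
    0 ≤ ∫ x in Ω, fderiv ℝ φ x (A (max (u x) k) - A k) ∂μ

variable [BorelSpace E]

/-- If `u < k + h` on the part `m < t` of the domain, then `u ≤ k` there. -/
theorem KruzhkovIneq.le_of_lt_add [μ.IsOpenPosMeasure] [IsFiniteMeasureOnCompacts μ]
    {A a : ℝ → E} (hA : ∀ v, HasDerivAt A (a v) v)
    {Ω : Set E} (hΩ : IsOpen Ω) {u : E → ℝ} (hu : ContinuousOn u Ω) (hE : KruzhkovIneq μ A Ω u)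
    {m s : E → ℝ} (hm : ContDiff ℝ ∞ m) (hs : ContDiff ℝ ∞ s) {t T k h : ℝ} (htT : t ≤ T)
    (hN : IsCompact {x | 0 ≤ s x ∧ m x ≤ T}) (hNΩ : {x | 0 ≤ s x ∧ m x ≤ T} ⊆ Ω)
    (hdm : ∀ v ∈ Ioo k (k + h), ∀ x ∈ {x | 0 ≤ s x ∧ m x ≤ T}, 0 < fderiv ℝ m x (a v))
    (hbase : ∀ x ∈ {x | 0 ≤ s x ∧ m x ≤ T}, s x ≤ 1 → u x ≤ k)
    (hlt : ∀ x ∈ {x | 0 ≤ s x ∧ m x ≤ T}, m x < t → u x < k + h) :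
    ∀ x ∈ {x | 0 ≤ s x ∧ m x ≤ T}, m x < t → u x ≤ k := by
  set N := {x | 0 ≤ s x ∧ m x ≤ T} with hNdef
  set φ := barrier m s t with hφdef
  have hφ : IsTestFunction Ω φ := isTestFunction_barrier hm hs htT hN hNΩ
  have hAc : Continuous A := continuous_iff_continuousAt.2 fun v ↦ (hA v).continuousAt
  set I : E → ℝ := fun x ↦ fderiv ℝ φ x (A (max (u x) k) - A k) with hI
  -- `A (u x) - A k` is the integral of `a` over `(k, u x)`, which lies in the range `(k, k + h)`
  -- where `m` increases along `a v`.
  have hincr : ∀ x ∈ N, m x < t → k < u x → 0 < fderiv ℝ m x (A (u x) - A k) := by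
    intro x hx hxt hxk
    have hd (v : ℝ) : HasDerivAt (fun v ↦ fderiv ℝ m x (A v)) (fderiv ℝ m x (a v)) v :=
      (fderiv ℝ m x).hasFDerivAt.comp_hasDerivAt v (hA v)
    have hmono : StrictMonoOn (fun v ↦ fderiv ℝ m x (A v)) (Icc k (u x)) := by
      refine strictMonoOn_of_deriv_pos (convex_Icc _ _)
        (fun v _ ↦ (hd v).continuousAt.continuousWithinAt) fun v hv ↦ ?_
      rw [interior_Icc] at hv
      rw [(hd v).deriv]
      exact hdm v ⟨hv.1, hv.2.trans (hlt x hx hxt)⟩ x hx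
    rw [map_sub, sub_pos]
    exact hmono ⟨le_rfl, hxk.le⟩ ⟨hxk.le, le_rfl⟩ hxk
  -- Where `u > k`, `hbase` forces `s > 1`, so the cutoff in `s` is locally constant and only the
  -- derivative in `m` remains.
  have hneg : ∀ x ∈ N, m x < t → k < u x → I x < 0 := by
    intro x hx hxt hxk
    have hs1 : 1 < s x := by
      by_contra hs1
      exact (hbase x hx (not_lt.1 hs1)).not_gt hxk
    have h0 : 0 < t - m x := sub_pos.2 hxt
    simp only [hI]
    rw [max_eq_left hxk.le, hφdef, fderiv_barrier hm hs.continuous hs1, neg_lt_zero]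
    have := hincr x hx hxt hxk
    have := expNegInvGlue.pos_of_pos h0
    positivity
  have hnonpos : ∀ x, I x ≤ 0 := by
    intro x
    by_cases hx : m x < t ∧ 0 < s x
    · rcases lt_or_ge k (u x) with hk | hk
      · exact (hneg x ⟨hx.2.le, hx.1.le.trans htT⟩ hx.1 hk).le
      · simp [hI, max_eq_right hk]
    · have h0 : φ x = 0 := barrier_eq_zero hx
      have : IsLocalMin φ x := Eventually.of_forall fun y ↦ by
        rw [h0]; exact barrier_nonneg _ _ _ _
      simp [hI, this.fderiv_eq_zero]
  have hwc : ContinuousOn (fun x ↦ A (max (u x) k) - A k) Ω :=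
    (hAc.comp_continuousOn (hu.sup continuousOn_const)).sub continuousOn_const
  have hIc : ContinuousOn I Ω := hφ.continuous_fderiv.continuousOn.clm_apply hwc
  have hIi : IntegrableOn I Ω μ := hφ.integrableOn_fderiv_apply hwc
  -- `I ≤ 0` has nonnegative integral by the entropy inequality; continuity upgrades a.e. vanishing
  -- to everywhere.
  have hzero : EqOn I 0 Ω := by
    refine Measure.eqOn_open_of_ae_eq (μ := μ) ?_ hΩ hIc continuousOn_const
    have h1 : ∫ x in Ω, -I x ∂μ = 0 := by
      refine le_antisymm ?_ (integral_nonneg fun x ↦ neg_nonneg.2 (hnonpos x))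
      rw [integral_neg, neg_nonpos]
      exact hE k φ hφ (barrier_nonneg _ _ _)
    have h2 := (integral_eq_zero_iff_of_nonneg (fun x ↦ neg_nonneg.2 (hnonpos x)) hIi.neg).1 h1
    filter_upwards [h2] with x hx
    simpa using hx
  intro x hx hxt
  by_contra hk
  exact (hneg x hx hxt (not_le.1 hk)).ne (hzero (hNΩ hx))

/-- The a priori bound `u < k + h` is removed by continuity. At a point of `{u ≥ k + h}` with least
`m`, the previous lemma gives `u ≤ k` at all lower levels of `m`; approaching the point from
upstream contradicts `u ≥ k + h`. -/
theorem KruzhkovIneq.le_of_barrier [μ.IsOpenPosMeasure] [IsFiniteMeasureOnCompacts μ]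
    {A a : ℝ → E} (hA : ∀ v, HasDerivAt A (a v) v) (ha : Continuous a)
    {Ω : Set E} (hΩ : IsOpen Ω) {u : E → ℝ} (hu : ContinuousOn u Ω) (hE : KruzhkovIneq μ A Ω u)
    {m s : E → ℝ} (hm : ContDiff ℝ ∞ m) (hs : ContDiff ℝ ∞ s) {T k : ℝ}
    (hN : IsCompact {x | 0 ≤ s x ∧ m x ≤ T}) (hNΩ : {x | 0 ≤ s x ∧ m x ≤ T} ⊆ Ω)
    (hdm : ∀ x ∈ {x | 0 ≤ s x ∧ m x ≤ T}, 0 < fderiv ℝ m x (a k))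
    (hbase : ∀ x ∈ {x | 0 ≤ s x ∧ m x ≤ T}, s x ≤ 1 → u x ≤ k) :
    ∀ x ∈ {x | 0 ≤ s x ∧ m x ≤ T}, m x < T → u x ≤ k := by
  set N := {x | 0 ≤ s x ∧ m x ≤ T} with hNdef
  obtain ⟨h, h0, hh⟩ : ∃ h > 0, ∀ v ∈ Ioo k (k + h), ∀ x ∈ N, 0 < fderiv ℝ m x (a v) := by
    have hc : Continuous fun p : ℝ × E ↦ fderiv ℝ m p.2 (a p.1) :=
      ((hm.continuous_fderiv (by simp)).comp continuous_snd).clm_apply (ha.comp continuous_fst)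
    have hev : ∀ᶠ v in 𝓝 k, ∀ x ∈ N, 0 < fderiv ℝ m x (a v) :=
      hN.eventually_forall_of_forall_eventually
        (P := fun v x ↦ 0 < fderiv ℝ m x (a v)) fun x hx ↦
          hc.continuousAt.eventually (lt_mem_nhds (hdm x hx))
    obtain ⟨h, h0, hh⟩ := Metric.eventually_nhds_iff.1 hev
    refine ⟨h, h0, fun v hv ↦ hh ?_⟩
    rw [Real.dist_eq, abs_of_pos (sub_pos.2 hv.1)]
    linarith [hv.2]
  have step {t : ℝ} (htT : t ≤ T) := hE.le_of_lt_add hA hΩ hu hm hs htT hN hNΩ hh hbase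
  set Z := N ∩ u ⁻¹' Ici (k + h) with hZ
  have hZc : IsCompact Z := hN.of_isClosed_subset
    ((hu.mono hNΩ).preimage_isClosed_of_isClosed hN.isClosed isClosed_Ici) inter_subset_left
  rcases Z.eq_empty_or_nonempty with hZe | hZn
  · refine step le_rfl fun x hx _ ↦ ?_
    by_contra hx'
    exact hZe.subset (show x ∈ Z from ⟨hx, not_lt.1 hx'⟩)
  · exfalso
    obtain ⟨z, ⟨hzN, hzu⟩, hzmin⟩ := hZc.exists_isMinOn hZn hm.continuous.continuousOn
    have hzu : k + h ≤ u z := hzu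
    have hle := step (t := m z) hzN.2 fun x hx hxz ↦ by
      by_contra hx'
      exact (hzmin (show x ∈ Z from ⟨hx, not_lt.1 hx'⟩)).not_gt hxz
    have hs1 : 1 < s z := by
      by_contra hs1
      linarith [hbase z hzN (not_lt.1 hs1)]
    -- points slightly upstream of `z`
    set γ : ℝ → E := fun τ ↦ z - τ • a k with hγ
    have hγ0 : γ 0 = z := by simp [hγ]
    have hγc : ContinuousAt γ 0 := by fun_prop
    have hγd : HasDerivAt γ (-(a k)) 0 := by
      simpa using ((hasDerivAt_id (0 : ℝ)).smul_const (a k)).const_sub z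
    have hmd : HasDerivAt (m ∘ γ) (-(fderiv ℝ m z (a k))) 0 := by
      have hd : HasFDerivAt m (fderiv ℝ m z) (γ 0) := by
        rw [hγ0]; exact (hm.differentiable (by simp)).differentiableAt.hasFDerivAt
      simpa using hd.comp_hasDerivAt 0 hγd
    have hdec : ∀ᶠ τ in 𝓝[>] (0 : ℝ), m (γ τ) < m z := by
      have h1 := (hasDerivAt_iff_tendsto_slope.1 hmd).mono_left
        (nhdsWithin_mono 0 (fun x hx ↦ ne_of_gt hx : Ioi (0 : ℝ) ⊆ {0}ᶜ))
      filter_upwards [h1.eventually (gt_mem_nhds (neg_lt_zero.2 (hdm z hzN))),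
        self_mem_nhdsWithin] with τ hτ h0τ
      rw [slope_def_field, Function.comp, Function.comp, hγ0, sub_zero,
        div_neg_iff] at hτ
      rcases hτ with hτ | hτ
      · exact absurd hτ.2 (not_lt.2 (le_of_lt h0τ))
      · linarith [hτ.1]
    have hγt : Tendsto γ (𝓝[>] 0) (𝓝 z) := by
      rw [← hγ0]; exact hγc.tendsto.mono_left nhdsWithin_le_nhds
    have huz : Tendsto (fun τ ↦ u (γ τ)) (𝓝[>] 0) (𝓝 (u z)) :=
      (hu.continuousAt (hΩ.mem_nhds (hNΩ hzN))).tendsto.comp hγt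
    have : u z ≤ k := by
      refine le_of_tendsto huz ?_
      filter_upwards [hdec, hγt.eventually (hs.continuous.continuousAt.eventually
        (lt_mem_nhds hs1))] with τ h1 h2
      exact hle _ ⟨zero_le_one.trans h2.le, h1.le.trans hzN.2⟩ h1
    linarith

end Barrier

/-! ### Propagation along characteristics. -/

section Propagation

variable {E : Type*} [NormedAddCommGroup E] [InnerProductSpace ℝ E] [FiniteDimensional ℝ E]
  [MeasurableSpace E] [BorelSpace E] {μ : Measure E}

/-- The barrier region is a slender paraboloid cap around the segment. Its function `m` has
derivative `1` along `a k`, and its base lies so close to `x₀` that `u < k` there. -/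
theorem KruzhkovIneq.le_of_lt [μ.IsOpenPosMeasure] [IsFiniteMeasureOnCompacts μ]
    {A a : ℝ → E} (hA : ∀ v, HasDerivAt A (a v) v) (ha : Continuous a)
    {Ω : Set E} (hΩ : IsOpen Ω) {u : E → ℝ} (hu : ContinuousOn u Ω) (hE : KruzhkovIneq μ A Ω u)
    {x₀ : E} {k T : ℝ} (hT : 0 ≤ T) (hk : u x₀ < k)
    (hseg : ∀ t ∈ Icc 0 T, x₀ + t • a k ∈ Ω) : u (x₀ + T • a k) ≤ k := by
  set e := a k with he
  rcases eq_or_ne e 0 with he0 | he0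
  · simpa [he0] using hk.le
  have hx₀ : x₀ ∈ Ω := by simpa using hseg 0 ⟨le_rfl, hT⟩
  set C : Set E := (fun t : ℝ ↦ x₀ + t • e) '' Icc 0 T with hC
  have hCc : IsCompact C := isCompact_Icc.image (by fun_prop)
  have hCΩ : C ⊆ Ω := by
    rintro _ ⟨t, ht, rfl⟩
    exact hseg t ht
  obtain ⟨ρ, hρ, hρΩ⟩ := hCc.exists_cthickening_subset_open hΩ hCΩ
  obtain ⟨r, hr, hru⟩ := Metric.eventually_nhds_iff.1
    ((hu.continuousAt (hΩ.mem_nhds hx₀)).eventually (gt_mem_nhds hk))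
  -- `δ * ‖e‖ + δ` bounds the distance from the cap to the segment and from its base to `x₀`: the
  -- first must stay within `ρ`, the second below `r`.
  obtain ⟨δ, hδ, hδρ, hδr⟩ : ∃ δ > 0, δ * ‖e‖ + δ ≤ ρ ∧ δ * ‖e‖ + δ < r := by
    have h1 : 0 < ‖e‖ + 1 := by positivity
    refine ⟨min ρ r / (2 * (‖e‖ + 1)), by positivity, ?_⟩
    have h2 : min ρ r / (2 * (‖e‖ + 1)) * ‖e‖ + min ρ r / (2 * (‖e‖ + 1)) = min ρ r / 2 := by
      field_simp
    rw [h2]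
    constructor <;> linarith [min_le_left ρ r, min_le_right ρ r, lt_min hρ hr]
  -- the coordinate along `e`, and the orthogonal part
  set l : E →L[ℝ] ℝ := (‖e‖ ^ 2)⁻¹ • innerSL ℝ e with hl
  have hle : l e = 1 := by
    have : ‖e‖ ^ 2 ≠ 0 := by positivity
    simp [hl, this]
  set P : E →L[ℝ] E := ContinuousLinearMap.id ℝ E - l.smulRight e with hP
  have hPe : P e = 0 := by simp [hP, hle]
  have hdecomp (z : E) : z = l z • e + P z := by simp [hP]
  -- On the cap `l ≥ -δ` and `m ≤ T + δ`, so `‖P (x - x₀)‖ ^ 2 ≤ c * (T + 2 * δ) = δ ^ 2`.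
  set c := δ ^ 2 / (T + 2 * δ) with hc
  have hc0 : 0 < c := by positivity
  set m : E → ℝ := fun x ↦ l (x - x₀) + c⁻¹ * ‖P (x - x₀)‖ ^ 2 with hm
  set s : E → ℝ := fun x ↦ (l (x - x₀) + δ) / δ with hs
  have hmc : ContDiff ℝ ∞ m := by
    refine (l.contDiff.comp (contDiff_id.sub contDiff_const)).add (contDiff_const.mul ?_)
    exact (P.contDiff.comp (contDiff_id.sub contDiff_const)).norm_sq ℝ
  have hsc : ContDiff ℝ ∞ s :=
    ((l.contDiff.comp (contDiff_id.sub contDiff_const)).add contDiff_const).div_const _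
  have hN : ∀ x ∈ {x | 0 ≤ s x ∧ m x ≤ T + δ},
      -δ ≤ l (x - x₀) ∧ l (x - x₀) ≤ T + δ ∧ ‖P (x - x₀)‖ ≤ δ := by
    rintro x ⟨h1, h2⟩
    have h1' : 0 ≤ l (x - x₀) + δ := by
      by_contra h
      exact h1.not_gt (div_neg_of_neg_of_pos (not_le.1 h) hδ)
    have h3 : 0 ≤ c⁻¹ * ‖P (x - x₀)‖ ^ 2 := by positivity
    have h2' : l (x - x₀) + c⁻¹ * ‖P (x - x₀)‖ ^ 2 ≤ T + δ := h2
    refine ⟨by linarith, by linarith, ?_⟩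
    have h4 : c⁻¹ * ‖P (x - x₀)‖ ^ 2 ≤ T + 2 * δ := by linarith
    rw [inv_mul_le_iff₀ hc0, hc, div_mul_cancel₀ _ (by positivity)] at h4
    exact le_of_sq_le_sq h4 hδ.le
  have hNC : {x | 0 ≤ s x ∧ m x ≤ T + δ} ⊆ Metric.cthickening ρ C := by
    intro x hx
    obtain ⟨h1, h2, h3⟩ := hN x hx
    set τ := max 0 (min (l (x - x₀)) T) with hτ
    have hτm : τ ∈ Icc 0 T := ⟨le_max_left _ _, max_le hT (min_le_right _ _)⟩
    have hτd : |l (x - x₀) - τ| ≤ δ := by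
      rw [abs_le, hτ]
      rcases le_total (l (x - x₀)) T with h | h
      · rw [min_eq_left h]
        rcases le_total 0 (l (x - x₀)) with h' | h'
        · rw [max_eq_right h']; constructor <;> linarith
        · rw [max_eq_left h']; constructor <;> linarith
      · rw [min_eq_right h, max_eq_right hT]; constructor <;> linarith
    refine Metric.mem_cthickening_of_dist_le x (x₀ + τ • e) _ _ ⟨τ, hτm, rfl⟩ (le_trans ?_ hδρ)
    have : x - (x₀ + τ • e) = (l (x - x₀) - τ) • e + P (x - x₀) := by
      rw [← sub_sub, sub_smul]
      nth_rewrite 1 [hdecomp (x - x₀)]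
      abel
    rw [dist_eq_norm, this]
    refine (norm_add_le _ _).trans (add_le_add ?_ h3)
    rw [norm_smul, Real.norm_eq_abs]
    gcongr
  have hNcl : IsClosed {x | 0 ≤ s x ∧ m x ≤ T + δ} :=
    (isClosed_le continuous_const hsc.continuous).inter
      (isClosed_le hmc.continuous continuous_const)
  have hNc : IsCompact {x | 0 ≤ s x ∧ m x ≤ T + δ} :=
    hCc.cthickening.of_isClosed_subset hNcl hNC
  have hdm (x : E) : fderiv ℝ m x e = 1 := by
    have h1 : HasFDerivAt (fun x ↦ l (x - x₀)) l x := 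
      l.hasFDerivAt.comp x ((hasFDerivAt_id x).sub_const x₀)
    have h2 : HasFDerivAt (fun x ↦ P (x - x₀)) P x := 
      P.hasFDerivAt.comp x ((hasFDerivAt_id x).sub_const x₀)
    have h3 : HasFDerivAt m _ x := h1.add (h2.norm_sq.const_mul c⁻¹)
    rw [h3.fderiv]
    simp [hPe, hle]
  -- The level is `T + δ` rather than `T` because the endpoint, where `m = T`, must lie strictly
  -- below it.
  refine hE.le_of_barrier hA ha hΩ hu hmc hsc hNc (hNC.trans hρΩ)
    (fun x _ ↦ by rw [← he, hdm]; exact zero_lt_one) (fun x hx hsx ↦ ?_) (x₀ + T • e) ?_ ?_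
  · obtain ⟨h1, h2, h3⟩ := hN x hx
    have h4 : l (x - x₀) ≤ 0 := by
      have : l (x - x₀) + δ ≤ 1 * δ := (div_le_iff₀ hδ).1 hsx
      linarith
    refine (hru ?_).le
    refine lt_of_le_of_lt ?_ hδr
    rw [dist_eq_norm, hdecomp (x - x₀)]
    refine (norm_add_le _ _).trans (add_le_add ?_ h3)
    rw [norm_smul, Real.norm_eq_abs, abs_of_nonpos h4]
    gcongr
    linarith
  · refine ⟨?_, ?_⟩
    · simp only [hs, add_sub_cancel_left, map_smul, hle]
      simp only [smul_eq_mul, mul_one]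
      positivity
    · simp only [hm, add_sub_cancel_left, map_smul, hle, hPe]
      simp [hδ.le]
  · simp only [hm, add_sub_cancel_left, map_smul, hle, hPe]
    simp [hδ]

/-- `KruzhkovIneq.le_of_lt` needs `u x₀ < k`, so `k` decreases to `u x₀`; the perturbed segments
stay in `Ω` by compactness. -/
theorem KruzhkovIneq.le_along [μ.IsOpenPosMeasure] [IsFiniteMeasureOnCompacts μ]
    {A a : ℝ → E} (hA : ∀ v, HasDerivAt A (a v) v) (ha : Continuous a)
    {Ω : Set E} (hΩ : IsOpen Ω) {u : E → ℝ} (hu : ContinuousOn u Ω) (hE : KruzhkovIneq μ A Ω u)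
    {x₀ : E} {T : ℝ} (hT : 0 ≤ T)
    (hseg : ∀ t ∈ Icc 0 T, x₀ + t • a (u x₀) ∈ Ω) : u (x₀ + T • a (u x₀)) ≤ u x₀ := by
  have hev : ∀ᶠ k in 𝓝[>] (u x₀), u (x₀ + T • a k) ≤ k := by
    have h1 : ∀ᶠ k in 𝓝 (u x₀), ∀ t ∈ Icc 0 T, x₀ + t • a k ∈ Ω := by
      refine isCompact_Icc.eventually_forall_of_forall_eventually
        (P := fun k t ↦ x₀ + t • a k ∈ Ω) fun t ht ↦ ?_
      have hc : Continuous fun p : ℝ × ℝ ↦ x₀ + p.2 • a p.1 := by fun_prop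
      exact hc.continuousAt.eventually (hΩ.mem_nhds (hseg t ht))
    filter_upwards [h1.filter_mono nhdsWithin_le_nhds, self_mem_nhdsWithin] with k hk hlt
    exact hE.le_of_lt hA ha hΩ hu hT hlt hk
  have hc : ContinuousAt (fun k ↦ u (x₀ + T • a k)) (u x₀) := by
    refine ContinuousAt.comp (g := u)
      (hu.continuousAt (hΩ.mem_nhds (hseg T ⟨hT, le_rfl⟩))) ?_
    fun_prop
  exact le_of_tendsto_of_tendsto (hc.tendsto.mono_left nhdsWithin_le_nhds)
    (tendsto_id.mono_left nhdsWithin_le_nhds) hev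

/-- A function satisfying the Kruzhkov inequalities and the equation itself is constant forward
along the characteristics. -/
theorem KruzhkovIneq.eq_along [μ.IsOpenPosMeasure] [IsFiniteMeasureOnCompacts μ]
    {A a : ℝ → E} (hA : ∀ v, HasDerivAt A (a v) v) (ha : Continuous a)
    {Ω : Set E} (hΩ : IsOpen Ω) {u : E → ℝ} (hu : ContinuousOn u Ω) (hE : KruzhkovIneq μ A Ω u)
    (hE0 : ∀ (k : ℝ) (φ : E → ℝ), IsTestFunction Ω φ → (∀ x, 0 ≤ φ x) →
      ∫ x in Ω, fderiv ℝ φ x (A (u x) - A k) ∂μ = 0)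
    {x₀ : E} {T : ℝ} (hT : 0 ≤ T)
    (hseg : ∀ t ∈ Icc 0 T, x₀ + t • a (u x₀) ∈ Ω) : u (x₀ + T • a (u x₀)) = u x₀ := by
  refine le_antisymm (hE.le_along hA ha hΩ hu hT hseg) ?_
  have hA' (v : ℝ) : HasDerivAt (fun v ↦ -A (-v)) (a (-v)) v := by
    have h : HasDerivAt (fun v ↦ -A (-v)) _ v := ((hA (-v)).scomp v (hasDerivAt_neg v)).neg
    simpa using h
  have hAc : Continuous A := continuous_iff_continuousAt.2 fun v ↦ (hA v).continuousAt
  -- Subtracting the equation from the inequality for `max u (-k)` leaves the flux `A (max u (-k)) -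
  -- A u`, which is the Kruzhkov flux of `-u`.
  have hE' : KruzhkovIneq μ (fun v ↦ -A (-v)) Ω (fun x ↦ -u x) := by
    intro k φ hφ hpos
    have hi1 : IntegrableOn (fun x ↦ fderiv ℝ φ x (A (max (u x) (-k)) - A (-k))) Ω μ :=
      hφ.integrableOn_fderiv_apply ((hAc.comp_continuousOn (hu.sup continuousOn_const)).sub continuousOn_const)
    have hi2 : IntegrableOn (fun x ↦ fderiv ℝ φ x (A (u x) - A (-k))) Ω μ :=
      hφ.integrableOn_fderiv_apply ((hAc.comp_continuousOn hu).sub continuousOn_const)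
    have hsub := integral_sub hi1 hi2
    rw [hE0 (-k) φ hφ hpos, sub_zero] at hsub
    have h1 := hE (-k) φ hφ hpos
    rw [← hsub] at h1
    convert h1 using 3 with x
    rw [← map_sub]
    congr 1
    rcases le_total (u x) (-k) with h | h
    · rw [max_eq_right h, max_eq_left (le_neg.1 h)]
      simp [neg_add_eq_sub]
    · rw [max_eq_left h, max_eq_right (neg_le.1 h)]
      simp
  have := hE'.le_along hA' (ha.comp continuous_neg) hΩ hu.neg (x₀ := x₀) hT (by simpa using hseg)
  simpa using this

end Propagation

/-! ### Transport of level sets and the layer cake formula. -/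

section LevelSets

variable {E : Type*} [NormedAddCommGroup E] [NormedSpace ℝ E]

/-- `u` is constant forward in time along its characteristics, for the velocity `a`. -/
def ConstForward (a : ℝ → E) (Ω : Set E) (u : E → ℝ) : Prop :=
  ∀ x ∈ Ω, ∀ T : ℝ, 0 ≤ T → (∀ t ∈ Icc 0 T, x + t • a (u x) ∈ Ω) → u (x + T • a (u x)) = u x

theorem eventually_translate_mem {K Ω : Set E} (hK : IsCompact K) (hΩ : IsOpen Ω) (hKΩ : K ⊆ Ω)
    (w : E) : ∀ᶠ s : ℝ in 𝓝[>] 0, ∀ x ∈ K, ∀ t ∈ Icc 0 s, x - t • w ∈ Ω := by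
  have h : ∀ᶠ s : ℝ in 𝓝 0, ∀ x ∈ K, x - s • w ∈ Ω := by
    refine hK.eventually_forall_of_forall_eventually
      (P := fun (s : ℝ) x ↦ x - s • w ∈ Ω) fun x hx ↦ ?_
    have hc : Continuous fun p : ℝ × E ↦ p.2 - p.1 • w := by fun_prop
    exact hc.continuousAt.eventually (hΩ.mem_nhds (by simpa using hKΩ hx))
  obtain ⟨ε, hε, h⟩ := Metric.eventually_nhds_iff.1 h
  filter_upwards [Ioo_mem_nhdsGT hε] with s hs x hx t ht
  refine h ?_ x hx
  rw [Real.dist_eq, sub_zero, abs_of_nonneg ht.1]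
  exact ht.2.trans_lt hs.2

theorem continuousOn_translate {Ω : Set E} {u : E → ℝ} (hu : ContinuousOn u Ω) {x w : E} {s : ℝ}
    (h : ∀ t ∈ Icc 0 s, x - t • w ∈ Ω) : ContinuousOn (fun t : ℝ ↦ u (x - t • w)) (Icc 0 s) :=
  hu.comp (by fun_prop) h

theorem ConstForward.eq_of_translate_eq {a : ℝ → E} {Ω : Set E} {u : E → ℝ}
    (hF : ConstForward a Ω u) {x : E} {v t : ℝ} (ht : 0 ≤ t)
    (h : ∀ τ ∈ Icc 0 t, x - τ • a v ∈ Ω) (hv : u (x - t • a v) = v) : u x = v := by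
  have := hF (x - t • a v) (h t ⟨ht, le_rfl⟩) t ht
  rw [hv, sub_add_cancel] at this
  refine this fun τ hτ ↦ ?_
  convert h (t - τ) ⟨sub_nonneg.2 hτ.2, by linarith [hτ.1]⟩ using 1
  rw [sub_smul]
  abel

/-- If the shifted point left `{u > v}`, then `u` would equal `v` somewhere on the way; forward
constancy would carry this value back to `x`. -/
theorem ConstForward.eventually_lt_translate {a : ℝ → E} {Ω : Set E} (hΩ : IsOpen Ω) {u : E → ℝ}
    (hu : ContinuousOn u Ω) (hF : ConstForward a Ω u) {K : Set E} (hK : IsCompact K)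
    (hKΩ : K ⊆ Ω) (v : ℝ) : ∀ᶠ s : ℝ in 𝓝[>] 0, ∀ x ∈ K, x ∈ Ω ∩ u ⁻¹' Ioi v →
      x - s • a v ∈ Ω ∩ u ⁻¹' Ioi v := by
  filter_upwards [eventually_translate_mem hK hΩ hKΩ (a v), self_mem_nhdsWithin] with s hs h0 x hx hxv
  have h0 : 0 ≤ s := le_of_lt h0
  refine ⟨hs x hx s ⟨h0, le_rfl⟩, ?_⟩
  by_contra hle
  obtain ⟨t, ht, htv⟩ := intermediate_value_Icc' h0 (continuousOn_translate hu (hs x hx))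
    ⟨not_lt.1 hle, by simpa using le_of_lt hxv.2⟩
  have := hF.eq_of_translate_eq ht.1 (fun τ hτ ↦ hs x hx τ ⟨hτ.1, hτ.2.trans ht.2⟩) htv
  exact (ne_of_gt hxv.2) this

/-- Either `u` takes the value `v` on the short segment, and constancy in both directions gives it
at both ends, or the intermediate value theorem keeps `u` on one side of `v`. -/
theorem eventually_translate_iff {a : ℝ → E} {Ω : Set E} (hΩ : IsOpen Ω) {u : E → ℝ}
    (hu : ContinuousOn u Ω) (hF : ConstForward a Ω u) (hB : ConstForward (-a) Ω u)
    {K : Set E} (hK : IsCompact K) (hKΩ : K ⊆ Ω) (v : ℝ) :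
    ∀ᶠ s : ℝ in 𝓝[>] 0, ∀ x ∈ K, x - s • a v ∈ Ω ∧ (v < u x ↔ v < u (x - s • a v)) ∧
      (u x < v ↔ u (x - s • a v) < v) := by
  filter_upwards [eventually_translate_mem hK hΩ hKΩ (a v), self_mem_nhdsWithin] with s hs h0 x hx
  have h0 : 0 ≤ s := le_of_lt h0
  refine ⟨hs x hx s ⟨h0, le_rfl⟩, ?_⟩
  by_cases hex : ∃ t ∈ Icc 0 s, u (x - t • a v) = v
  · obtain ⟨t, ht, htv⟩ := hex
    have h1 : u x = v :=
      hF.eq_of_translate_eq ht.1 (fun τ hτ ↦ hs x hx τ ⟨hτ.1, hτ.2.trans ht.2⟩) htv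
    have h2 : u (x - s • a v) = v := by
      refine hB.eq_of_translate_eq (t := s - t) (sub_nonneg.2 ht.2) (fun τ hτ ↦ ?_) ?_
      · convert hs x hx (s - τ) ⟨by linarith [hτ.2, ht.1], by linarith [hτ.1]⟩ using 1
        rw [Pi.neg_apply, sub_smul, smul_neg]
        abel
      · rw [← htv]
        congr 1
        rw [htv, Pi.neg_apply]
        module
    simp [h1, h2]
  · have hiv := intermediate_value_uIcc (a := 0) (b := s) (f := fun t : ℝ ↦ u (x - t • a v))
      (by rw [uIcc_of_le h0]; exact continuousOn_translate hu (hs x hx))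
    have hv : v ∉ uIcc (u x) (u (x - s • a v)) := by
      intro hv
      obtain ⟨t, ht, htv⟩ := hiv (by simpa using hv)
      rw [uIcc_of_le h0] at ht
      exact hex ⟨t, ht, htv⟩
    rw [mem_uIcc, not_or, not_and_or, not_and_or, not_le, not_le, not_le, not_le] at hv
    constructor <;> constructor <;> intro h <;> rcases hv with ⟨h1 | h1, h2 | h2⟩ <;> linarith

variable [FiniteDimensional ℝ E] [MeasurableSpace E] [BorelSpace E] {μ : Measure E}
  [μ.IsAddHaarMeasure]

theorem IsTestFunction.integral_fderiv_const {Ω : Set E} (hΩ : IsOpen Ω) {φ : E → ℝ}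
    (hφ : IsTestFunction Ω φ) (w : E) : ∫ x in Ω, fderiv ℝ φ x w ∂μ = 0 := by
  refine setIntegral_fderiv_eq_zero hφ hΩ.measurableSet w ?_
  filter_upwards [eventually_translate_mem hφ.compact hΩ hφ.support_subset w,
    self_mem_nhdsWithin] with s hs h0 x hx
  simp [hφ.support_subset hx, hs x hx s ⟨le_of_lt h0, le_rfl⟩]

/-- Layer cake decomposition of the integral of `∇φ · ∫_{-M}^u b`. -/
theorem IsTestFunction.integral_fderiv_primitive {Ω : Set E} (hΩ : IsOpen Ω) {u : E → ℝ}
    (hu : ContinuousOn u Ω) {φ : E → ℝ} (hφ : IsTestFunction Ω φ) {M : ℝ}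
    (hM : ∀ x ∈ tsupport φ, |u x| ≤ M) {b : ℝ → E} (hb : IntegrableOn b (Ioc (-M) M)) :
    IntegrableOn (fun v ↦ ∫ x in Ω ∩ u ⁻¹' Ioi v, fderiv ℝ φ x (b v) ∂μ) (Ioc (-M) M) ∧
    ∫ x in Ω, fderiv ℝ φ x (∫ v in (-M)..u x, b v) ∂μ =
      ∫ v in Ioc (-M) M, ∫ x in Ω ∩ u ⁻¹' Ioi v, fderiv ℝ φ x (b v) ∂μ := by
  classical
  set K := tsupport φ with hK
  have hKm : MeasurableSet K := (isClosed_tsupport φ).measurableSet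
  have hKΩ : K ⊆ Ω := hφ.support_subset
  -- `u` is controlled only on `Ω`; this extension is globally measurable and agrees with `u`
  -- wherever `∇φ ≠ 0`.
  set ũ : E → ℝ := K.piecewise u 0 with hũ
  have hũm : Measurable ũ :=
    (hu.mono hKΩ).measurable_piecewise continuousOn_const hKm
  set S : Set (E × ℝ) := {p | p.2 < ũ p.1} with hS
  have hSm : MeasurableSet S := measurableSet_lt measurable_snd (hũm.comp measurable_fst)
  obtain ⟨C, hC⟩ := hφ.exists_bound
  have : IsFiniteMeasure (μ.restrict K) := ⟨by simpa using hφ.compact.measure_lt_top⟩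
  set F : E → ℝ → ℝ := fun x v ↦ S.indicator (fun p ↦ fderiv ℝ φ p.1 (b p.2)) (x, v) with hF
  have hFi : Integrable (Function.uncurry F) ((μ.restrict K).prod (volume.restrict (Ioc (-M) M))) := by
    refine Integrable.indicator ?_ hSm
    refine Integrable.mono' ((hb.norm.const_mul C).comp_snd (μ.restrict K)) ?_
      (ae_of_all _ fun p ↦ (ContinuousLinearMap.le_opNorm _ _).trans ?_)
    · exact isBoundedBilinearMap_apply.continuous.comp_aestronglyMeasurable
        ((hφ.continuous_fderiv.comp continuous_fst).aestronglyMeasurable.prodMk hb.1.comp_snd)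
    · exact mul_le_mul_of_nonneg_right (hC _) (norm_nonneg _)
  have hright (v : ℝ) : ∫ x in K, F x v ∂μ = ∫ x in Ω ∩ u ⁻¹' Ioi v, fderiv ℝ φ x (b v) ∂μ := by
    have h1 : ∫ x in K, F x v ∂μ =
        ∫ x in K, {x | v < ũ x}.indicator (fun x ↦ fderiv ℝ φ x (b v)) x ∂μ := rfl
    rw [h1, setIntegral_indicator (measurableSet_lt measurable_const hũm)]
    symm
    have hsub : K ∩ {x | v < ũ x} ⊆ Ω ∩ u ⁻¹' Ioi v := by
      rintro x ⟨hx, hxv⟩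
      refine ⟨hKΩ hx, ?_⟩
      simpa [hũ, hx] using hxv
    refine setIntegral_eq_of_subset_of_forall_sdiff_eq_zero
      (hu.isOpen_inter_preimage hΩ isOpen_Ioi).measurableSet hsub fun x hx ↦ ?_
    have hxK : x ∉ K := fun hxK ↦ hx.2 ⟨hxK, by
      have := hx.1.2
      simpa [hũ, hxK] using this⟩
    simp [hφ.fderiv_eq_zero hxK]
  have hleft : ∀ x ∈ K, fderiv ℝ φ x (∫ v in (-M)..u x, b v) = ∫ v in Ioc (-M) M, F x v := by
    intro x hx
    obtain ⟨h1, h2⟩ := abs_le.1 (hM x hx)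
    have h3 : ∫ v in Ioc (-M) M, F x v =
        ∫ v in Ioc (-M) M, (Iio (ũ x)).indicator (fun v ↦ fderiv ℝ φ x (b v)) v := rfl
    have hux : ũ x = u x := by simp [hũ, hx]
    rw [h3, setIntegral_indicator measurableSet_Iio, hux, intervalIntegral.integral_of_le h1]
    have h4 : (Ioc (-M) M ∩ Iio (u x) : Set ℝ) =ᵐ[volume] Ioc (-M) (u x) := by
      have : Ioc (-M) (u x) = Ioc (-M) M ∩ Iic (u x) := by
        rw [Ioc_inter_Iic, min_eq_right h2]
      rw [this]
      exact (ae_eq_refl _).inter Iio_ae_eq_Iic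
    rw [setIntegral_congr_set h4]
    exact ((fderiv ℝ φ x).integral_comp_comm
      (hb.mono_set (Ioc_subset_Ioc_right h2))).symm
  constructor
  · have := hFi.integral_prod_right
    simp only [Function.uncurry] at this
    simp_rw [hright] at this
    exact this
  · rw [setIntegral_eq_of_subset_of_forall_sdiff_eq_zero hΩ.measurableSet hKΩ
      fun x hx ↦ by simp [hφ.fderiv_eq_zero hx.2], setIntegral_congr_fun hKm hleft,
      integral_integral_swap hFi]
    simp_rw [hright]

/-- If almost all level sets of `u` contribute zero, then `∫ ∇φ · ∫_{-M}^u b a = 0`. -/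
theorem IsTestFunction.integral_fderiv_primitive_eq_zero {Ω : Set E} (hΩ : IsOpen Ω) {u : E → ℝ}
    (hu : ContinuousOn u Ω) {φ : E → ℝ} (hφ : IsTestFunction Ω φ) {M : ℝ}
    (hM : ∀ x ∈ tsupport φ, |u x| ≤ M) {a : ℝ → E} {b : ℝ → ℝ}
    (hb : IntegrableOn (fun v ↦ b v • a v) (Ioc (-M) M))
    (hG : ∀ᵐ v ∂volume.restrict (Ioc (-M) M),
      ∫ x in Ω ∩ u ⁻¹' Ioi v, fderiv ℝ φ x (a v) ∂μ = 0) :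
    ∫ x in Ω, fderiv ℝ φ x (∫ v in (-M)..u x, b v • a v) ∂μ = 0 := by
  rw [(hφ.integral_fderiv_primitive hΩ hu hM hb).2]
  refine integral_eq_zero_of_ae ?_
  filter_upwards [hG] with v hv
  simp_rw [map_smul, smul_eq_mul, integral_const_mul, hv, mul_zero, Pi.zero_apply]

/-- Every level contributes a nonnegative amount, and the layer cake total is the left side of `h0`.
-/
theorem ConstForward.ae_level_eq_zero {A a : ℝ → E} (hA : ∀ v, HasDerivAt A (a v) v)
    (ha : Continuous a) {Ω : Set E} (hΩ : IsOpen Ω) {u : E → ℝ} (hu : ContinuousOn u Ω)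
    (hF : ConstForward a Ω u) {φ : E → ℝ} (hφ : IsTestFunction Ω φ) (hpos : ∀ x, 0 ≤ φ x) {M : ℝ}
    (hM : ∀ x ∈ tsupport φ, |u x| ≤ M)
    (h0 : ∫ x in Ω, fderiv ℝ φ x (A (u x) - A (-M)) ∂μ = 0) :
    ∀ᵐ v ∂volume.restrict (Ioc (-M) M),
      ∫ x in Ω ∩ u ⁻¹' Ioi v, fderiv ℝ φ x (a v) ∂μ = 0 := by
  have hi : IntegrableOn a (Ioc (-M) M) :=
    (ha.integrableOn_Icc).mono_set Ioc_subset_Icc_self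
  obtain ⟨h1, h2⟩ := hφ.integral_fderiv_primitive (μ := μ) hΩ hu hM hi
  have h3 (v : ℝ) : 0 ≤ ∫ x in Ω ∩ u ⁻¹' Ioi v, fderiv ℝ φ x (a v) ∂μ :=
    setIntegral_fderiv_nonneg hφ hpos (hu.isOpen_inter_preimage hΩ isOpen_Ioi).measurableSet _
      (hF.eventually_lt_translate hΩ hu hφ.compact hφ.support_subset v)
  have h4 (v : ℝ) : ∫ s in (-M)..v, a s = A v - A (-M) :=
    intervalIntegral.integral_eq_sub_of_hasDerivAt (fun s _ ↦ hA s) (ha.intervalIntegrable _ _)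
  simp_rw [h4, h0] at h2
  exact (integral_eq_zero_iff_of_nonneg h3 h1).1 h2.symm

end LevelSets

/-! ### Entropy fluxes and reversal of the characteristics. -/

section EntropyFlux

variable {d : ℕ} {A a : ℝ → EuclideanSpace ℝ (Fin d)}

theorem ConvexOn.monotone_derivWithin_Ioi {η : ℝ → ℝ} (hη : ConvexOn ℝ univ η) :
    Monotone fun s ↦ derivWithin η (Ioi s) s := by
  have := hη.monotoneOn_rightDeriv
  rwa [interior_univ, monotoneOn_univ] at this

theorem intervalIntegrable_derivWithin_smul (ha : Continuous a) {η : ℝ → ℝ}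
    (hη : ConvexOn ℝ univ η) (v w : ℝ) :
    IntervalIntegrable (fun s ↦ derivWithin η (Ioi s) s • a s) volume v w :=
  hη.monotone_derivWithin_Ioi.intervalIntegrable.smul_continuousOn ha.continuousOn

theorem IsEntropyFlux.eq_add (ha : Continuous a) {η : ℝ → ℝ} (hη : ConvexOn ℝ univ η)
    {q : ℝ → EuclideanSpace ℝ (Fin d)} (hq : IsEntropyFlux a η q) (v w : ℝ) :
    q w = q v + ∫ s in v..w, derivWithin η (Ioi s) s • a s := by
  rw [hq w, hq v, add_assoc, intervalIntegral.integral_add_adjacent_intervals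
    (intervalIntegrable_derivWithin_smul ha hη _ _)
    (intervalIntegrable_derivWithin_smul ha hη _ _)]

/-- A continuous function with the right one-sided derivatives is an entropy flux. -/
theorem isEntropyFlux_of_hasDerivWithinAt (ha : Continuous a) {η : ℝ → ℝ}
    (hη : ConvexOn ℝ univ η) {q : ℝ → EuclideanSpace ℝ (Fin d)} (hqc : Continuous q)
    (hq : ∀ s, HasDerivWithinAt q (derivWithin η (Ioi s) s • a s) (Ioi s) s) :
    IsEntropyFlux a η q := fun v ↦ by
  rw [intervalIntegral.integral_eq_sub_of_hasDeriv_right hqc.continuousOn (fun s _ ↦ hq s)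
    (intervalIntegrable_derivWithin_smul ha hη _ _)]
  abel

theorem convexOn_max_right (k : ℝ) : ConvexOn ℝ univ fun v : ℝ ↦ max v k :=
  (convexOn_id convex_univ).sup (convexOn_const k convex_univ)

theorem isEntropyFlux_max (hA : ∀ v, HasDerivAt A (a v) v) (ha : Continuous a) (k : ℝ) :
    IsEntropyFlux a (fun v ↦ max v k) fun v ↦ A (max v k) - A k := by
  have hAc : Continuous A := continuous_iff_continuousAt.2 fun v ↦ (hA v).continuousAt
  refine isEntropyFlux_of_hasDerivWithinAt ha (convexOn_max_right k) (by fun_prop) fun s ↦ ?_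
  rcases lt_or_ge s k with hs | hs
  · have h : (fun v : ℝ ↦ max v k) =ᶠ[𝓝 s] fun _ ↦ k := by
      filter_upwards [gt_mem_nhds hs] with v hv using max_eq_right hv.le
    have h1 : HasDerivAt (fun v : ℝ ↦ max v k) 0 s := (hasDerivAt_const s k).congr_of_eventuallyEq h
    rw [h1.hasDerivWithinAt.derivWithin (uniqueDiffWithinAt_Ioi s), zero_smul]
    refine ((hasDerivAt_const s (A k - A k)).congr_of_eventuallyEq ?_).hasDerivWithinAt
    filter_upwards [h] with v hv
    rw [hv]
  · have h : ∀ v ∈ Ioi s, max v k = v := fun v hv ↦ max_eq_left (hs.trans (le_of_lt hv))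
    have h1 : HasDerivWithinAt (fun v : ℝ ↦ max v k) 1 (Ioi s) s :=
      (hasDerivWithinAt_id s _).congr h (max_eq_left hs)
    rw [h1.derivWithin (uniqueDiffWithinAt_Ioi s), one_smul]
    refine ((hA s).sub_const (A k)).hasDerivWithinAt.congr (fun v hv ↦ ?_) ?_
    · rw [h v hv]
    · rw [max_eq_left hs]

theorem convexOn_neg_id : ConvexOn ℝ univ fun v : ℝ ↦ -v :=
  (concaveOn_id convex_univ).neg

theorem isEntropyFlux_id (hA : ∀ v, HasDerivAt A (a v) v) (ha : Continuous a) (k : ℝ) :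
    IsEntropyFlux a (fun v ↦ v) fun v ↦ A v - A k := by
  have hAc : Continuous A := continuous_iff_continuousAt.2 fun v ↦ (hA v).continuousAt
  refine isEntropyFlux_of_hasDerivWithinAt ha (convexOn_id convex_univ) (by fun_prop) fun s ↦ ?_
  rw [(hasDerivWithinAt_id s _).derivWithin (uniqueDiffWithinAt_Ioi s), one_smul]
  exact ((hA s).sub_const _).hasDerivWithinAt

theorem isEntropyFlux_neg (hA : ∀ v, HasDerivAt A (a v) v) (ha : Continuous a) (k : ℝ) :
    IsEntropyFlux a (fun v ↦ -v) fun v ↦ -(A v - A k) := by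
  have hAc : Continuous A := continuous_iff_continuousAt.2 fun v ↦ (hA v).continuousAt
  refine isEntropyFlux_of_hasDerivWithinAt ha convexOn_neg_id (by fun_prop) fun s ↦ ?_
  rw [(hasDerivAt_neg' s).hasDerivWithinAt.derivWithin (uniqueDiffWithinAt_Ioi s), neg_smul,
    one_smul]
  exact ((hA s).sub_const _).neg.hasDerivWithinAt

variable {Ω : Set (EuclideanSpace ℝ (Fin d))} {u : EuclideanSpace ℝ (Fin d) → ℝ}

theorem IsEntropySolution.kruzhkovIneq (hA : ∀ v, HasDerivAt A (a v) v) (ha : Continuous a)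
    (hu : IsEntropySolution a Ω u) : KruzhkovIneq volume A Ω u := fun k φ hφ hpos ↦
  hu.entropy _ _ (convexOn_max_right k) (isEntropyFlux_max hA ha k) φ hφ hpos

/-- Both `v` and `-v` are convex entropies, with opposite fluxes. -/
theorem IsEntropySolution.integral_eq_zero (hA : ∀ v, HasDerivAt A (a v) v) (ha : Continuous a)
    (hu : IsEntropySolution a Ω u) (k : ℝ) (φ : EuclideanSpace ℝ (Fin d) → ℝ)
    (hφ : IsTestFunction Ω φ) (hpos : ∀ x, 0 ≤ φ x) :
    ∫ x in Ω, fderiv ℝ φ x (A (u x) - A k) = 0 := by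
  refine le_antisymm ?_
    (hu.entropy _ _ (convexOn_id convex_univ) (isEntropyFlux_id hA ha k) φ hφ hpos)
  have := hu.entropy _ _ convexOn_neg_id (isEntropyFlux_neg hA ha k) φ hφ hpos
  simp_rw [map_neg, integral_neg] at this
  linarith

/-- If almost all level sets of `u` contribute zero, then there is equality in the entropy
inequalities. -/
theorem IsEntropyFlux.integral_fderiv_eq_zero (ha : Continuous a) (hΩ : IsOpen Ω)
    (hu : ContinuousOn u Ω) {η : ℝ → ℝ} (hη : ConvexOn ℝ univ η)
    {q : ℝ → EuclideanSpace ℝ (Fin d)} (hq : IsEntropyFlux a η q)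
    {φ : EuclideanSpace ℝ (Fin d) → ℝ} (hφ : IsTestFunction Ω φ) {M : ℝ}
    (hM : ∀ x ∈ tsupport φ, |u x| ≤ M)
    (hG : ∀ᵐ v ∂volume.restrict (Ioc (-M) M),
      ∫ x in Ω ∩ u ⁻¹' Ioi v, fderiv ℝ φ x (a v) = 0) :
    ∫ x in Ω, fderiv ℝ φ x (q (u x)) = 0 := by
  have hint := intervalIntegrable_derivWithin_smul ha hη
  have hb : IntegrableOn (fun v ↦ derivWithin η (Ioi v) v • a v) (Ioc (-M) M) := (hint _ _).1
  have h0 := hφ.integral_fderiv_primitive_eq_zero hΩ hu hM hb hG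
  have hc : Continuous fun w ↦ ∫ v in (-M)..w, derivWithin η (Ioi v) v • a v :=
    intervalIntegral.continuous_primitive hint _
  have hi1 : IntegrableOn (fun x ↦ fderiv ℝ φ x (q (-M))) Ω :=
    hφ.integrableOn_fderiv_apply continuousOn_const
  have hi2 : IntegrableOn (fun x ↦ fderiv ℝ φ x
      (∫ v in (-M)..u x, derivWithin η (Ioi v) v • a v)) Ω :=
    hφ.integrableOn_fderiv_apply (hc.comp_continuousOn hu)
  have h1 : ∀ x, fderiv ℝ φ x (q (u x)) = fderiv ℝ φ x (q (-M)) +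
      fderiv ℝ φ x (∫ v in (-M)..u x, derivWithin η (Ioi v) v • a v) := fun x ↦ by
    rw [← map_add, ← hq.eq_add ha hη]
  simp_rw [h1]
  rw [integral_add hi1 hi2, hφ.integral_fderiv_const hΩ, zero_add]
  exact h0

theorem IsTestFunction.exists_abs_le {φ : EuclideanSpace ℝ (Fin d) → ℝ}
    (hφ : IsTestFunction Ω φ) (hu : ContinuousOn u Ω) : ∃ M, ∀ x ∈ tsupport φ, |u x| ≤ M :=
  hφ.compact.exists_bound_of_continuousOn (hu.mono hφ.support_subset)

theorem IsEntropySolution.constForward (hA : ∀ v, HasDerivAt A (a v) v) (ha : Continuous a)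
    (hΩ : IsOpen Ω) (hc : ContinuousOn u Ω) (hu : IsEntropySolution a Ω u) :
    ConstForward a Ω u := fun _ _ _ hT hseg ↦
  (hu.kruzhkovIneq hA ha).eq_along hA ha hΩ hc (hu.integral_eq_zero hA ha) hT hseg

/-- Forward constancy already rules out dissipation for the Kruzhkov entropies, so their
inequalities are equalities and survive the sign change `A ↦ -A`. -/
theorem IsEntropySolution.constBackward (hA : ∀ v, HasDerivAt A (a v) v) (ha : Continuous a)
    (hΩ : IsOpen Ω) (hc : ContinuousOn u Ω) (hu : IsEntropySolution a Ω u) :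
    ConstForward (-a) Ω u := by
  have hF := hu.constForward hA ha hΩ hc
  have hE : KruzhkovIneq volume (-A) Ω u := by
    intro k φ hφ hpos
    obtain ⟨M, hM⟩ := hφ.exists_abs_le hc
    have h := (isEntropyFlux_max hA ha k).integral_fderiv_eq_zero ha hΩ hc
      (convexOn_max_right k) hφ hM
      (hF.ae_level_eq_zero hA ha hΩ hc hφ hpos hM (hu.integral_eq_zero hA ha _ φ hφ hpos))
    refine ge_of_eq ?_
    rw [← neg_zero, ← h, ← integral_neg]
    congr 1 with x
    rw [← map_neg]
    congr 1
    simp only [Pi.neg_apply]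
    abel
  intro x hx T hT hseg
  refine hE.eq_along (fun v ↦ (hA v).neg) ha.neg hΩ hc (fun k φ hφ hpos ↦ ?_) hT hseg
  rw [← neg_zero, ← hu.integral_eq_zero hA ha k φ hφ hpos, ← integral_neg]
  congr 1 with x
  rw [← map_neg]
  congr 1
  simp only [Pi.neg_apply]
  abel

end EntropyFlux

/-! ### The kinetic equation without source. -/

section Kinetic

variable {E : Type*} [NormedAddCommGroup E] [NormedSpace ℝ E]

theorem IsTestFunction.slice {Ω : Set E} {φ : E × ℝ → ℝ}
    (hφ : IsTestFunction (Ω ×ˢ (univ : Set ℝ)) φ) (v : ℝ) :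
    IsTestFunction Ω fun x ↦ φ (x, v) := by
  have hsub : tsupport (fun x ↦ φ (x, v)) ⊆ (fun x ↦ (x, v)) ⁻¹' tsupport φ :=
    closure_minimal (fun x hx ↦ subset_tsupport φ hx)
      ((isClosed_tsupport φ).preimage (by fun_prop))
  refine ⟨hφ.smooth.comp (contDiff_id.prodMk contDiff_const), ?_,
    fun x hx ↦ (hφ.support_subset (hsub hx)).1⟩
  exact (hφ.compact.isCompact.image continuous_fst).of_isClosed_subset (isClosed_tsupport _)
    fun x hx ↦ ⟨(x, v), hsub hx, rfl⟩

theorem IsTestFunction.fderiv_slice {Ω : Set E} {φ : E × ℝ → ℝ}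
    (hφ : IsTestFunction (Ω ×ˢ (univ : Set ℝ)) φ) (v : ℝ) (x w : E) :
    fderiv ℝ (fun x ↦ φ (x, v)) x w = fderiv ℝ φ (x, v) (w, 0) := by
  have h1 : HasFDerivAt φ (fderiv ℝ φ (x, v)) (x, v) :=
    (hφ.smooth.differentiable (by simp)).differentiableAt.hasFDerivAt
  have h2 : HasFDerivAt (fun x ↦ φ (x, v)) _ x := h1.comp x (hasFDerivAt_prodMk_left x v)
  rw [h2.fderiv]
  simp

theorem abs_kineticFunction_le {X : Type*} (u : X → ℝ) (x : X) (v : ℝ) :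
    ‖kineticFunction u x v‖ ≤ 1 := by
  unfold kineticFunction
  split_ifs <;> simp

theorem measurable_kineticFunction {X : Type*} [MeasurableSpace X] {u : X → ℝ}
    (hu : Measurable u) : Measurable fun p : X × ℝ ↦ kineticFunction u p.1 p.2 := by
  classical
  have h1 : Measurable fun p : X × ℝ ↦ u p.1 := hu.comp measurable_fst
  unfold kineticFunction
  refine Measurable.ite ?_ measurable_const (Measurable.ite ?_ measurable_const measurable_const)
  · exact (measurableSet_lt measurable_const measurable_snd).inter
      (measurableSet_lt measurable_snd h1)
  · exact (measurableSet_lt h1 measurable_snd).inter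
      (measurableSet_lt measurable_snd measurable_const)

variable [FiniteDimensional ℝ E] [MeasurableSpace E] [BorelSpace E] {μ : Measure E}
  [μ.IsAddHaarMeasure]

/-- Two-sided invariance gives this for every `v` and for `φ` of any sign. Both strict level sets
are treated because `{u = v}` may have positive measure. -/
theorem integral_level_eq_zero {a : ℝ → E} {Ω : Set E} (hΩ : IsOpen Ω) {u : E → ℝ}
    (hu : ContinuousOn u Ω) (hF : ConstForward a Ω u) (hB : ConstForward (-a) Ω u)
    {φ : E → ℝ} (hφ : IsTestFunction Ω φ) (v : ℝ) :
    ∫ x in Ω ∩ u ⁻¹' Ioi v, fderiv ℝ φ x (a v) ∂μ = 0 ∧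
      ∫ x in Ω ∩ u ⁻¹' Iio v, fderiv ℝ φ x (a v) ∂μ = 0 := by
  have h := eventually_translate_iff hΩ hu hF hB hφ.compact hφ.support_subset v
  constructor
  · refine setIntegral_fderiv_eq_zero hφ
      (hu.isOpen_inter_preimage hΩ isOpen_Ioi).measurableSet _ ?_
    filter_upwards [h] with s hs x hx
    obtain ⟨h1, h2, -⟩ := hs x hx
    simp [hφ.support_subset hx, h1, h2]
  · refine setIntegral_fderiv_eq_zero hφ
      (hu.isOpen_inter_preimage hΩ isOpen_Iio).measurableSet _ ?_
    filter_upwards [h] with s hs x hx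
    obtain ⟨h1, -, h2⟩ := hs x hx
    simp [hφ.support_subset hx, h1, h2]

/-- At a fixed `v` the kinetic function is the indicator of `{u > v}` if `v > 0`, minus that of `{u
< v}` if `v < 0`, and zero if `v = 0`. -/
theorem integral_kineticFunction_slice_eq_zero {a : ℝ → E} {Ω : Set E} (hΩ : IsOpen Ω)
    {u : E → ℝ} (hu : ContinuousOn u Ω) (hF : ConstForward a Ω u) (hB : ConstForward (-a) Ω u)
    {φ : E → ℝ} (hφ : IsTestFunction Ω φ) (v : ℝ) :
    ∫ x in Ω, kineticFunction u x v * fderiv ℝ φ x (a v) ∂μ = 0 := by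
  obtain ⟨h1, h2⟩ := integral_level_eq_zero (μ := μ) hΩ hu hF hB hφ v
  have key {S : Set ℝ} (hS : IsOpen S) {c : ℝ} (hf : ∀ x ∈ Ω,
      kineticFunction u x v = (u ⁻¹' S).indicator (fun _ ↦ c) x) :
      ∫ x in Ω, kineticFunction u x v * fderiv ℝ φ x (a v) ∂μ =
        c * ∫ x in Ω ∩ u ⁻¹' S, fderiv ℝ φ x (a v) ∂μ := by
    rw [← integral_const_mul, ← integral_indicator (hu.isOpen_inter_preimage hΩ hS).measurableSet,
      ← integral_indicator hΩ.measurableSet]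
    congr 1 with x
    by_cases hx : x ∈ Ω
    · rw [indicator_of_mem hx, hf x hx]
      by_cases hxS : x ∈ u ⁻¹' S
      · rw [indicator_of_mem hxS, indicator_of_mem (show x ∈ Ω ∩ u ⁻¹' S from ⟨hx, hxS⟩)]
      · rw [indicator_of_notMem hxS, indicator_of_notMem fun h ↦ hxS h.2, zero_mul]
    · rw [indicator_of_notMem hx, indicator_of_notMem fun h ↦ hx h.1]
  rcases lt_trichotomy v 0 with hv | hv | hv
  · rw [key isOpen_Iio (c := -1) fun x _ ↦ ?_, h2, mul_zero]
    by_cases h : u x < v <;> simp [kineticFunction, hv, hv.not_gt, h]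
  · subst hv
    simp [kineticFunction]
  · rw [key isOpen_Ioi (c := 1) fun x _ ↦ ?_, h1, mul_zero]
    by_cases h : v < u x <;> simp [kineticFunction, hv, hv.not_gt, h]

theorem integral_kineticFunction_eq_zero {a : ℝ → E} (ha : Continuous a) {Ω : Set E}
    (hΩ : IsOpen Ω) {u : E → ℝ} (hu : ContinuousOn u Ω) (hF : ConstForward a Ω u)
    (hB : ConstForward (-a) Ω u) {φ : E × ℝ → ℝ}
    (hφ : IsTestFunction (Ω ×ˢ (univ : Set ℝ)) φ) :
    ∫ p in Ω ×ˢ (univ : Set ℝ), kineticFunction u p.1 p.2 * fderiv ℝ φ p (a p.2, 0)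
      ∂(μ.prod volume) = 0 := by
  classical
  have hm : Measurable (Ω.piecewise u 0) :=
    hu.measurable_piecewise continuousOn_const hΩ.measurableSet
  have hg : Continuous fun p : E × ℝ ↦ fderiv ℝ φ p (a p.2, 0) :=
    hφ.continuous_fderiv.clm_apply (by fun_prop)
  have hgi : Integrable (fun p : E × ℝ ↦ fderiv ℝ φ p (a p.2, 0)) (μ.prod volume) := by
    refine hg.integrable_of_hasCompactSupport ((hφ.compact.fderiv ℝ).mono fun p hp ↦ ?_)
    intro h0
    exact hp (by simp [h0])
  have hi : IntegrableOn (fun p : E × ℝ ↦ kineticFunction u p.1 p.2 * fderiv ℝ φ p (a p.2, 0))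
      (Ω ×ˢ univ) (μ.prod volume) := by
    have h1 : Integrable (fun p : E × ℝ ↦ kineticFunction (Ω.piecewise u 0) p.1 p.2 *
        fderiv ℝ φ p (a p.2, 0)) (μ.prod volume) :=
      hgi.bdd_mul (measurable_kineticFunction hm).aestronglyMeasurable
        (ae_of_all _ fun p ↦ abs_kineticFunction_le _ _ _)
    refine h1.integrableOn.congr_fun (fun p hp ↦ ?_) (hΩ.measurableSet.prod MeasurableSet.univ)
    simp only [kineticFunction, piecewise_eq_of_mem _ _ _ hp.1]
  rw [IntegrableOn, ← Measure.prod_restrict] at hi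
  rw [← Measure.prod_restrict, integral_prod_symm _ hi]
  refine integral_eq_zero_of_ae (ae_of_all _ fun v ↦ ?_)
  simp_rw [← hφ.fderiv_slice v]
  exact integral_kineticFunction_slice_eq_zero hΩ hu hF hB (hφ.slice v) v

end Kinetic

/-! ### Vanishing of the dissipation measure. -/

section Uniqueness

variable {E : Type*} [NormedAddCommGroup E] [NormedSpace ℝ E] [FiniteDimensional ℝ E]
  [MeasurableSpace E] [BorelSpace E]

/-- A nonnegative measure on `Ω × ℝ` that is finite on the sets `K × ℝ` and does not depend on `v`
in the sense of distributions vanishes. -/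
theorem measure_eq_zero_of_integral_fderiv_eq_zero {Ω : Set E} (hΩ : IsOpen Ω)
    {μ : Measure (E × ℝ)}
    (hfin : ∀ K : Set E, IsCompact K → K ⊆ Ω → μ (K ×ˢ (univ : Set ℝ)) < ⊤)
    (h : ∀ φ : E × ℝ → ℝ, IsTestFunction (Ω ×ˢ (univ : Set ℝ)) φ →
      ∫ p in Ω ×ˢ (univ : Set ℝ), fderiv ℝ φ p (0, 1) ∂μ = 0) :
    μ (Ω ×ˢ (univ : Set ℝ)) = 0 := by
  obtain ⟨g, -, hgc, hgs, -, hg0⟩ := exists_contDiff_tsupport_subset (n := ⊤)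
    (univ_mem : (univ : Set ℝ) ∈ 𝓝 (0 : ℝ))
  -- A compactly supported function with slope `1` at `0`: `G (ε * v) / ε` replaces the inadmissible
  -- test function `v` as `ε → 0`.
  set G : ℝ → ℝ := fun v ↦ v * g v with hG
  have hGs : ContDiff ℝ ∞ G := contDiff_id.mul hgs
  have hGc : HasCompactSupport G := hgc.mul_left
  have hG' : deriv G 0 = 1 := by
    have h1 : HasDerivAt G (1 * g 0 + 0 * deriv g 0) 0 :=
      (hasDerivAt_id (0 : ℝ)).mul (hgs.differentiable (by simp)).differentiableAt.hasDerivAt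
    rw [h1.deriv, hg0]
    simp
  have hG'c : Continuous (deriv G) := hGs.continuous_deriv (by simp)
  obtain ⟨C, hC⟩ := hGc.deriv.exists_bound_of_continuous hG'c
  refine measure_null_of_locally_null _ fun p hp ↦ ?_
  obtain ⟨χ, hχΩ, hχc, hχs, hχr, hχ1⟩ := exists_contDiff_tsupport_subset (n := ⊤)
    (hΩ.mem_nhds hp.1)
  have hχ : IsTestFunction Ω χ := ⟨hχs, hχc, hχΩ⟩
  have hscaled : ∀ ε : ℝ, ε ≠ 0 →
      ∫ p in Ω ×ˢ (univ : Set ℝ), χ p.1 * deriv G (ε * p.2) ∂μ = 0 := by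
    intro ε hε
    set φ : E × ℝ → ℝ := fun p ↦ χ p.1 * G (ε * p.2) with hφ
    have hsub : tsupport φ ⊆ tsupport χ ×ˢ tsupport fun v ↦ G (ε * v) := by
      refine closure_minimal (fun p hp ↦ ?_) ((isClosed_tsupport _).prod (isClosed_tsupport _))
      exact ⟨subset_tsupport _ (left_ne_zero_of_mul hp),
        subset_tsupport (fun v ↦ G (ε * v)) (right_ne_zero_of_mul hp)⟩
    have hGε : HasCompactSupport fun v ↦ G (ε * v) :=
      hGc.comp_homeomorph (Homeomorph.mulLeft₀ ε hε)
    have hφt : IsTestFunction (Ω ×ˢ (univ : Set ℝ)) φ := by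
      refine ⟨?_, ?_, hsub.trans (prod_mono hχΩ (subset_univ _))⟩
      · exact (hχs.comp contDiff_fst).mul (hGs.comp (contDiff_const.mul contDiff_snd))
      · exact (hχc.isCompact.prod hGε.isCompact).of_isClosed_subset (isClosed_tsupport _) hsub
    have hd (p : E × ℝ) : fderiv ℝ φ p (0, 1) = ε * (χ p.1 * deriv G (ε * p.2)) := by
      have h1 : HasFDerivAt (fun p : E × ℝ ↦ χ p.1) _ p :=
        ((hχs.differentiable (by simp)).differentiableAt.hasFDerivAt).comp p hasFDerivAt_fst
      have h2 : HasFDerivAt (fun p : E × ℝ ↦ G (ε * p.2)) _ p :=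
        HasDerivAt.comp_hasFDerivAt p
          (hGs.differentiable (by simp)).differentiableAt.hasDerivAt
          (HasFDerivAt.const_mul (hasFDerivAt_snd (𝕜 := ℝ) (E := E) (F := ℝ) (p := p)) ε)
      have h3 : HasFDerivAt φ _ p := h1.mul h2
      rw [h3.fderiv]
      simp
      ring
    have h0 := h φ hφt
    simp_rw [hd, integral_const_mul] at h0
    exact (mul_eq_zero.1 h0).resolve_left hε
  set K := tsupport χ with hK
  have hKm : MeasurableSet (K ×ˢ (univ : Set ℝ)) :=
    (isClosed_tsupport χ).measurableSet.prod MeasurableSet.univ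
  have hΩm : MeasurableSet (Ω ×ˢ (univ : Set ℝ)) := hΩ.measurableSet.prod MeasurableSet.univ
  -- The dominating function for `ε → 0`; finiteness of `μ` on all of `K × ℝ` is essential here.
  have hbi : Integrable ((K ×ˢ (univ : Set ℝ)).indicator fun _ ↦ C) μ :=
    (integrable_indicator_iff hKm).2 (integrableOn_const (hfin K hχc hχΩ).ne)
  have hbound (p : E × ℝ) (w : ℝ) (hw : ‖w‖ ≤ C) :
      ‖χ p.1 * w‖ ≤ (K ×ˢ (univ : Set ℝ)).indicator (fun _ ↦ C) p := by
    by_cases hp : p.1 ∈ K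
    · rw [indicator_of_mem (show p ∈ K ×ˢ (univ : Set ℝ) from ⟨hp, mem_univ _⟩), norm_mul]
      have h1 := hχr ⟨p.1, rfl⟩
      rw [Real.norm_of_nonneg h1.1]
      exact (mul_le_of_le_one_left (norm_nonneg _) h1.2).trans hw
    · simp [image_eq_zero_of_notMem_tsupport hp, hp]
  have hmeas (ε : ℝ) : Continuous fun p : E × ℝ ↦ χ p.1 * deriv G (ε * p.2) := by
    have := hχs.continuous
    fun_prop
  have hlim : Tendsto (fun n : ℕ ↦ ∫ p in Ω ×ˢ (univ : Set ℝ),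
      χ p.1 * deriv G ((1 / ((n : ℝ) + 1)) * p.2) ∂μ) atTop
      (𝓝 (∫ p in Ω ×ˢ (univ : Set ℝ), χ p.1 * deriv G (0 * p.2) ∂μ)) := by
    refine tendsto_integral_of_dominated_convergence _
      (fun n ↦ (hmeas _).aestronglyMeasurable) hbi.integrableOn
      (fun n ↦ ae_of_all _ fun p ↦ hbound p _ (hC _)) (ae_of_all _ fun p ↦ ?_)
    exact ((hG'c.tendsto _).comp
      (tendsto_one_div_add_atTop_nhds_zero_nat.mul_const p.2)).const_mul _
  have hz : ∫ p in Ω ×ˢ (univ : Set ℝ), χ p.1 * deriv G (0 * p.2) ∂μ = 0 :=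
    tendsto_nhds_unique hlim (tendsto_const_nhds.congr fun n ↦
      (hscaled _ (by positivity)).symm)
  simp_rw [zero_mul, hG', mul_one] at hz
  have hχi : IntegrableOn (fun p : E × ℝ ↦ χ p.1) (Ω ×ˢ (univ : Set ℝ)) μ := by
    refine (Integrable.mono' hbi
      (hmeas 0).aestronglyMeasurable (ae_of_all _ fun p ↦ hbound p _ (hC _))).integrableOn.congr_fun
      (fun p _ ↦ ?_) hΩm
    simp [hG']
  have hae := (integral_eq_zero_iff_of_nonneg (fun p : E × ℝ ↦ (hχr ⟨p.1, rfl⟩).1) hχi).1 hz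
  refine ⟨Ω ×ˢ (univ : Set ℝ) ∩ {p | χ p.1 ≠ 0}, inter_mem self_mem_nhdsWithin
    (mem_nhdsWithin_of_mem_nhds ?_), ?_⟩
  · refine (isOpen_ne_fun (hχs.continuous.comp continuous_fst) continuous_const).mem_nhds ?_
    simp [hχ1]
  · have h1 : μ.restrict (Ω ×ˢ (univ : Set ℝ)) {p | χ p.1 ≠ 0} = 0 := hae
    rw [Measure.restrict_apply' hΩm, inter_comm] at h1
    exact h1

end Uniqueness

/-! ### The theorem, assembled from constancy in both directions. -/

theorem lemmal {d : ℕ} (A : ℝ → EuclideanSpace ℝ (Fin d)) (hA : ContDiff ℝ 1 A)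
    (Ω : Set (EuclideanSpace ℝ (Fin d))) (hΩ : IsOpen Ω)
    (u : EuclideanSpace ℝ (Fin d) → ℝ) (hcont : ContinuousOn u Ω)
    (hu : IsEntropySolution (deriv A) Ω u) :
    -- `u` is constant along characteristic segments
    (∀ x₀ ∈ Ω, ∀ r s : ℝ, 0 < r → 0 < s →
      (∀ t ∈ Ioo (-r) s, x₀ + t • deriv A (u x₀) ∈ Ω) →
      ∀ t ∈ Ioo (-r) s, u (x₀ + t • deriv A (u x₀)) = u x₀) ∧
    -- the kinetic entropy dissipation measure exists and vanishes
    (IsKineticDissipation (deriv A) Ω u 0 ∧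
      ∀ μ : Measure (EuclideanSpace ℝ (Fin d) × ℝ),
        IsKineticDissipation (deriv A) Ω u μ → μ (Ω ×ˢ (univ : Set ℝ)) = 0) ∧
    -- equality in the entropy inequalities
    (∀ (η : ℝ → ℝ) (q : ℝ → EuclideanSpace ℝ (Fin d)),
      ConvexOn ℝ univ η → IsEntropyFlux (deriv A) η q →
      ∀ φ : EuclideanSpace ℝ (Fin d) → ℝ, IsTestFunction Ω φ →
        ∫ x in Ω, fderiv ℝ φ x (q (u x)) = 0) := by
  have hd : ∀ v, HasDerivAt A (deriv A v) v := fun v ↦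
    (hA.differentiable (by simp)).differentiableAt.hasDerivAt
  have ha : Continuous (deriv A) := hA.continuous_deriv (by simp)
  have hF := hu.constForward hd ha hΩ hcont
  have hB := hu.constBackward hd ha hΩ hcont
  have hkin : ∀ φ : EuclideanSpace ℝ (Fin d) × ℝ → ℝ,
      IsTestFunction (Ω ×ˢ (univ : Set ℝ)) φ →
      ∫ p in Ω ×ˢ (univ : Set ℝ), kineticFunction u p.1 p.2 * fderiv ℝ φ p (deriv A p.2, 0) = 0 :=
    fun φ hφ ↦ integral_kineticFunction_eq_zero ha hΩ hcont hF hB hφ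
  refine ⟨fun x₀ hx₀ r s hr hs hseg t ht ↦ ?_, ⟨⟨?_, fun φ hφ ↦ ?_⟩, fun μ hμ ↦ ?_⟩, ?_⟩
  · rcases le_total 0 t with h0 | h0
    · exact hF x₀ hx₀ t h0 fun τ hτ ↦ hseg τ ⟨by linarith [hτ.1], hτ.2.trans_lt ht.2⟩
    · have := hB x₀ hx₀ (-t) (neg_nonneg.2 h0) fun τ hτ ↦ by
        have := hseg (-τ) ⟨by linarith [hτ.2, ht.1], by linarith [hτ.1]⟩
        simpa using this
      simpa using this
  · simp
  · simp [hkin φ hφ]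
  · refine measure_eq_zero_of_integral_fderiv_eq_zero hΩ hμ.finite fun φ hφ ↦ ?_
    rw [← hμ.equation φ hφ, hkin φ hφ]
  · intro η q hη hq φ hφ
    obtain ⟨M, hM⟩ := hφ.exists_abs_le hcont
    exact hq.integral_fderiv_eq_zero ha hΩ hcont hη hφ hM
      (ae_of_all _ fun v ↦ (integral_level_eq_zero hΩ hcont hF hB hφ v).1)
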